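/- Let $X$ be a real or complex Banach space, $X^*$ its dual and $B_{X^*}$ the closed unit ball of $X^*$. A set $B\subseteq B_{X^*}$ is said to (I)-generate $B_{X^*}$ if, whenever $B=\bigcup_{n=1}^\infty B_n$, the ball $B_{X^*}$ is equal to the norm-closed convex hull of $\bigcup_{n=1}^\infty \overline{\mathrm{co}}^{\,w^*}(B_n)$, where $\overline{\mathrm{co}}^{\,w^*}$ denotes the weak*-closed convex hull. An infinite matrix $A=(a_{nk})_{n,k\in\mathbb N}$ is regular if for every convergent scalar sequence $(s_k)$ with limit $s$ the series $\sum_k a_{nk}s_k$ converge for all $n$ and $\lim_{n\to\infty}\sum_k a_{nk}s_k=s$; it is positive if $a_{nk}\ge 0$ for all $n,k$. For a positive regular matrix $A$, a scalar sequence $(s_k)$ is strongly $A$-convergent to $s$ if $\sum_k a_{nk}|s_k-s|<\infty$ for every $n$ and $\lim_{n\to\infty}\sum_k a_{nk}|s_k-s|=0$. It is statistically convergent to $s$ if $\lim_{n\to\infty}\frac1n|\{k\le n:|s_k-s|\ge\varepsilon\}|=0$ for every $\varepsilon>0$. Suppose that $B\subseteq B_{X^*}$ (I)-generates $B_{X^*}$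 and that $M\subseteq X$ is bounded. (a) If for each sequence $(x_n)_{n\in\mathbb N}$ in $M$ there are a positive regular matrix $A$ and an $x\in X$ such that $(x^*(x_n))_{n\in\mathbb N}$ is strongly $A$-convergent to $x^*(x)$ for all $x^*\in B$, then $M$ is relatively weakly compact (its closure in the weak topology of $X$ is weakly compact). (b) In particular, $M$ is relatively weakly compact if each sequence $(x_n)_{n\in\mathbb N}$ in $M$ has a subsequence $(x_{n_k})_{k\in\mathbb N}$ for which there is an $x\in X$ such that $(x^*(x_{n_k}))_{k\in\mathbb N}$ is statistically convergent to $x^*(x)$ for all $x^*\in B$. -/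

import Mathlib

open Filter Topology

namespace WeakCom

section Generating

variable {𝕜 X : Type*} [RCLike 𝕜] [NormedAddCommGroup X] [NormedSpace 𝕜 X]

/-- The weak*-closed convex hull of a subset `S` of the dual space (convexity is over `ℝ`). -/
def weakStarClosedConvexHull (S : Set (StrongDual 𝕜 X)) : Set (StrongDual 𝕜 X) :=
  StrongDual.toWeakDual ⁻¹' closure (StrongDual.toWeakDual '' convexHull ℝ S)

/-- `B` (I)-generates `K`: `B ⊆ K`, and whenever `B` is a countable union of sets `C n`, the set `K`
is the norm-closed convex hull of the union of the weak*-closed convex hulls of the `C n`. -/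
def IGenerates (B K : Set (StrongDual 𝕜 X)) : Prop :=
  B ⊆ K ∧ ∀ C : ℕ → Set (StrongDual 𝕜 X), B = ⋃ n, C n →
    K = closure (convexHull ℝ (⋃ n, weakStarClosedConvexHull (C n)))

variable (𝕜) in
/-- `M` is relatively weakly compact: its closure in the weak topology is weakly compact. -/
def IsRelativelyWeaklyCompact (M : Set X) : Prop :=
  IsCompact (closure (toWeakSpace 𝕜 X '' M))

end Generating

/-- `A`-convergence of `s` to `l`: for each `n` the series `∑ₖ A n k * s k` converges (its partial
sums do, absolute convergence is not required), and its sums `t n` tend to `l`. -/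
def MatrixConverges (A : ℕ → ℕ → ℂ) (s : ℕ → ℂ) (l : ℂ) : Prop :=
  ∃ t : ℕ → ℂ,
    (∀ n, Tendsto (fun N => ∑ k ∈ Finset.range N, A n k * s k) atTop (𝓝 (t n))) ∧
      Tendsto t atTop (𝓝 l)

/-- A regular matrix: every convergent sequence is `A`-convergent to the same limit. -/
def IsRegularMatrix (A : ℕ → ℕ → ℂ) : Prop :=
  ∀ (s : ℕ → ℂ) (l : ℂ), Tendsto s atTop (𝓝 l) → MatrixConverges A s l

/-- A positive regular matrix: all entries are nonnegative reals, and the matrix is regular. -/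
def IsPositiveRegular (A : ℕ → ℕ → ℝ) : Prop :=
  (∀ n k, 0 ≤ A n k) ∧ IsRegularMatrix (fun n k => (A n k : ℂ))

section Convergence

variable {𝕜 : Type*} [RCLike 𝕜]

/-- Strong `A`-convergence (with index `1`) of `s` to `l`. -/
def StronglyConverges (A : ℕ → ℕ → ℝ) (s : ℕ → 𝕜) (l : 𝕜) : Prop :=
  (∀ n, Summable fun k => A n k * ‖s k - l‖) ∧
    Tendsto (fun n => ∑' k, A n k * ‖s k - l‖) atTop (𝓝 0)

open Classical in
/-- Statistical convergence of `s` to `l`. Indices start at `0`, so the first `n` indices are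
those in `Finset.range n`. -/
def StatConverges (s : ℕ → 𝕜) (l : 𝕜) : Prop :=
  ∀ ε : ℝ, 0 < ε →
    Tendsto (fun n : ℕ => (((Finset.range n).filter fun k => ε ≤ ‖s k - l‖).card : ℝ) / (n : ℝ))
      atTop (𝓝 0)

end Convergence

end WeakCom

/-! By Whitley's form of the Eberlein–Šmulian theorem, it is enough that every sequence `x` in the
bounded set `M` has a weak cluster point `y`. Fix `ε` and consider the functionals whose `A`-means
along `x k - y` are at most `ε` from row `n` on. They form a convex weak*-closed set, increasing in
`n`, and these sets cover `B`. So (I)-generation makes their union norm-dense in the dual ball, and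
bounded row sums carry the estimate to norm limits (`IGenerates.eventuallySmallMeans`). Small means
for all functionals force clustering at `y`: otherwise finitely many functionals would have total
means at least `ε` times the tail mass of a row, which tends to `1`
(`isWeakClusterPt_of_eventuallySmallMeans`). Statistical convergence enters through Cesàro means,
bounded sequences being at hand. -/

namespace WeakCom

/-! ### Weak cluster points and relative weak compactness. -/

section EberleinSmulian

variable {𝕜 X : Type*} [RCLike 𝕜] [NormedAddCommGroup X] [NormedSpace 𝕜 X]

variable (𝕜) in
/-- `y` is a cluster point of the sequence `x` in the weak topology, expressed by finitely many
functionals at a time. -/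
def IsWeakClusterPt (x : ℕ → X) (y : X) : Prop :=
  ∀ (S : Finset (StrongDual 𝕜 X)) (ε : ℝ), 0 < ε → ∀ N : ℕ, ∃ k ≥ N, ∀ f ∈ S, ‖f (x k) - f y‖ < ε

/-- A finite-dimensional space of functionals is normed, up to a factor `2`, by finitely many
vectors. -/
theorem exists_finset_norming (E : Submodule 𝕜 (StrongDual 𝕜 X)) [FiniteDimensional 𝕜 E] :
    ∃ S : Finset X, (∀ x ∈ S, ‖x‖ ≤ 1) ∧
      ∀ e ∈ E, ∀ c : ℝ, 0 ≤ c → (∀ x ∈ S, ‖e x‖ ≤ c) → ‖e‖ ≤ 2 * c := by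
  have : ProperSpace E := FiniteDimensional.proper_rclike 𝕜 E
  have hex : ∀ e : E, ∃ x : X, ‖x‖ ≤ 1 ∧ (‖e‖ = 1 → 1 / 2 < ‖(e : StrongDual 𝕜 X) x‖) := by
    intro e
    by_cases he : ‖e‖ = 1
    · obtain ⟨x, hx, hx'⟩ := (e : StrongDual 𝕜 X).exists_lt_apply_of_lt_opNorm
        (r := 1 / 2) (by rw [Submodule.norm_coe, he]; norm_num)
      exact ⟨x, hx.le, fun _ => hx'⟩
    · exact ⟨0, by simp, fun h => absurd h he⟩
  choose v hv hv' using hex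
  have hcont : ∀ x : X, Continuous fun e : E => ‖(e : StrongDual 𝕜 X) x‖ := fun x => by fun_prop
  obtain ⟨t, ht, hcov⟩ := (isCompact_sphere (0 : E) 1).elim_nhds_subcover
    (fun e => {e' : E | 1 / 2 < ‖(e' : StrongDual 𝕜 X) (v e)‖})
    (fun e he => (isOpen_lt continuous_const (hcont _)).mem_nhds (hv' e ((dist_zero_right e).symm.trans he)))
  classical
  refine ⟨t.image v, ?_, ?_⟩
  · simp only [Finset.mem_image]
    rintro _ ⟨e, -, rfl⟩
    exact hv e
  · intro e he c hc h
    by_cases h0 : e = 0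
    · simp [h0, hc]
    have hn : 0 < ‖e‖ := norm_pos_iff.2 h0
    have hu : ‖((‖e‖⁻¹ : ℝ) : 𝕜) • (⟨e, he⟩ : E)‖ = 1 := by
      change ‖((‖e‖⁻¹ : ℝ) : 𝕜) • e‖ = 1
      rw [norm_smul, RCLike.norm_ofReal, abs_inv, abs_norm]
      exact inv_mul_cancel₀ hn.ne'
    have hmem : ((‖e‖⁻¹ : ℝ) : 𝕜) • (⟨e, he⟩ : E) ∈ Metric.sphere (0 : E) 1 :=
      (dist_zero_right (((‖e‖⁻¹ : ℝ) : 𝕜) • (⟨e, he⟩ : E))).trans hu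
    obtain ⟨e', he', hlt⟩ := Set.mem_iUnion₂.1 (hcov hmem)
    have h1 := h (v e') (Finset.mem_image_of_mem v he')
    simp only [Set.mem_ofPred_eq, Submodule.coe_smul, smul_apply, norm_smul,
      RCLike.norm_ofReal, abs_inv, abs_norm] at hlt
    rw [inv_mul_eq_div, lt_div_iff₀ hn] at hlt
    linarith

/-- Otherwise a functional on the quotient by the closed span separates `y` from all terms. -/
theorem IsWeakClusterPt.mem_closure_span {x : ℕ → X} {y : X} (h : IsWeakClusterPt 𝕜 x y) :
    y ∈ (Submodule.span 𝕜 (Set.range x)).topologicalClosure := by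
  by_contra hy
  have : IsClosed ((Submodule.span 𝕜 (Set.range x)).topologicalClosure : Set X) :=
    Submodule.isClosed_topologicalClosure _
  obtain ⟨g, hg⟩ := SeparatingDual.exists_ne_zero (R := 𝕜)
    (mt (Submodule.Quotient.mk_eq_zero _).1 hy)
  let f : StrongDual 𝕜 X := g.comp (Submodule.mkQL _)
  have hfy : f y ≠ 0 := hg
  obtain ⟨k, -, hk⟩ := h {f} ‖f y‖ (norm_pos_iff.2 hfy) 0
  have hfx : f (x k) = 0 := by
    have : Submodule.Quotient.mk (x k) = 0 := (Submodule.Quotient.mk_eq_zero _).2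
      (Submodule.le_topologicalClosure (Submodule.span 𝕜 (Set.range x))
        (Submodule.subset_span (Set.mem_range_self k)))
    exact (congrArg g this).trans (map_zero g)
  have := hk f (by simp)
  simp [hfx] at this

theorem exists_mem_approx_of_mem_closure {M : Set X} {T : StrongDual 𝕜 (StrongDual 𝕜 X)}
    (hT : StrongDual.toWeakDual T ∈
      closure (NormedSpace.inclusionInDoubleDualWeak 𝕜 X '' (toWeakSpace 𝕜 X '' M)))
    (S : Finset (StrongDual 𝕜 X)) {ε : ℝ} (hε : 0 < ε) :
    ∃ a ∈ M, ∀ f ∈ S, ‖T f - f a‖ < ε := by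
  have hU : {V : WeakDual 𝕜 (StrongDual 𝕜 X) | ∀ f ∈ S, ‖T f - V f‖ < ε} ∈
      𝓝 (StrongDual.toWeakDual T) := by
    refine (Filter.eventually_all_finset S).2 fun f _ => ?_
    have hc : Continuous fun V : WeakDual 𝕜 (StrongDual 𝕜 X) => ‖T f - V f‖ :=
      (continuous_const.sub (WeakDual.eval_continuous f)).norm
    exact (hc.tendsto _).eventually_lt_const (by simpa using hε)
  obtain ⟨_, hV, ⟨_, ⟨a, ha, rfl⟩, rfl⟩⟩ := mem_closure_iff_nhds.1 hT _ hU
  exact ⟨a, ha, hV⟩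

/-- The nontrivial half of the Eberlein–Šmulian theorem, by Whitley's argument. -/
theorem isRelativelyWeaklyCompact_of_forall_exists_isWeakClusterPt {M : Set X}
    (hM : Bornology.IsBounded M)
    (h : ∀ x : ℕ → X, (∀ n, x n ∈ M) → ∃ y, IsWeakClusterPt 𝕜 x y) :
    IsRelativelyWeaklyCompact 𝕜 M := by
  classical
  -- It remains to show that each weak* limit point of `M` in the bidual comes from `X`.
  refine NormedSpace.isCompact_closure_of_isBounded 𝕜 X _
    (by rwa [Set.preimage_image_eq _ (toWeakSpace 𝕜 X).injective]) fun W hW => ?_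
  obtain ⟨T, rfl⟩ := StrongDual.toWeakDual.surjective W
  let J := NormedSpace.inclusionInDoubleDual 𝕜 X
  have hpick : ∀ (S : Finset (StrongDual 𝕜 X)) (n : ℕ),
      ∃ a ∈ M, ∀ f ∈ S, ‖T f - f a‖ < 1 / ((n : ℝ) + 1) := fun S n =>
    exists_mem_approx_of_mem_closure hW S (by positivity)
  choose P hPM hP using hpick
  let E : Finset X → Submodule 𝕜 (StrongDual 𝕜 (StrongDual 𝕜 X)) := fun t =>
    Submodule.span 𝕜 (insert T (t.image J : Finset _) : Finset _)
  have hnorming := fun t : Finset X => exists_finset_norming (E t)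
  choose G hG1 hG using hnorming
  -- The chosen sets `G` need not be monotone; the union over all subsets makes `a k` approximate
  -- `T` on every earlier norming set as well.
  let Q : Finset X → Finset (StrongDual 𝕜 X) := fun t => t.powerset.biUnion G
  let t : ℕ → Finset X := fun n => Nat.rec ∅ (fun n s => insert (P (Q s) n) s) n
  let a : ℕ → X := fun n => P (Q (t n)) n
  have htsucc : ∀ n, t (n + 1) = insert (a n) (t n) := fun n => rfl
  have htmono : Monotone t := monotone_nat_of_le_succ fun n => by
    rw [htsucc]; exact Finset.subset_insert _ _
  have hGQ : ∀ {m n}, m ≤ n → G (t m) ⊆ Q (t n) := fun hmn =>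
    Finset.subset_biUnion_of_mem G (Finset.mem_powerset.2 (htmono hmn))
  obtain ⟨y, hy⟩ := h a fun n => hPM _ _
  have hTy : ∀ n, ∀ f ∈ G (t n), T f = f y := by
    intro n f hf
    refine eq_of_forall_dist_le fun δ hδ => ?_
    obtain ⟨m, hm⟩ := exists_nat_one_div_lt (half_pos hδ)
    obtain ⟨k, hk, hkf⟩ := hy {f} (δ / 2) (half_pos hδ) (max n m)
    have h1 := hP (Q (t k)) k f (hGQ ((le_max_left n m).trans hk) hf)
    have h2 : 1 / ((k : ℝ) + 1) ≤ 1 / ((m : ℝ) + 1) :=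
      Nat.one_div_le_one_div ((le_max_right n m).trans hk)
    have h3 := hkf f (by simp)
    have h4 : ‖T f - f (a k)‖ < δ / 2 := h1.trans (h2.trans_lt hm)
    rw [dist_eq_norm]
    calc ‖T f - f y‖ ≤ ‖T f - f (a k)‖ + ‖f (a k) - f y‖ := norm_sub_le_norm_sub_add_norm_sub ..
      _ ≤ δ := by linarith
  refine ⟨toWeakSpace 𝕜 X y, ?_⟩
  change StrongDual.toWeakDual (J y) = StrongDual.toWeakDual T
  congr 1
  refine eq_of_forall_dist_le fun ε hε => ?_
  have hy' : y ∈ closure (Submodule.span 𝕜 (Set.range a) : Set X) := hy.mem_closure_span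
  obtain ⟨z, hz, hyz⟩ := Metric.mem_closure_iff.1 hy' (ε / 3) (by positivity)
  have hzt : ∃ n : ℕ, z ∈ Submodule.span 𝕜 (SetLike.coe (t n)) := by
    have hle : Submodule.span 𝕜 (Set.range a) ≤ ⨆ n, Submodule.span 𝕜 (SetLike.coe (t n)) := by
      refine Submodule.span_le.2 ?_
      rintro _ ⟨n, rfl⟩
      refine Submodule.mem_iSup_of_mem (n + 1) (Submodule.subset_span ?_)
      rw [htsucc]; simp
    exact (Submodule.mem_iSup_of_directed _ (Monotone.directed_le fun m n hmn =>
      Submodule.span_mono (Finset.coe_subset.2 (htmono hmn)))).1 (hle hz)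
  obtain ⟨n, hn⟩ := hzt
  have hJz : J z ∈ E (t n) := by
    have : Submodule.span 𝕜 (SetLike.coe (t n)) ≤ (E (t n)).comap (J : X →ₗ[𝕜] _) := by
      refine Submodule.span_le.2 fun x hx => Submodule.subset_span ?_
      simp only [Finset.coe_insert, Finset.coe_image]
      exact Or.inr ⟨x, hx, rfl⟩
    exact this hn
  have hTE : T ∈ E (t n) := Submodule.subset_span (by simp)
  have hyz' : ‖y - z‖ < ε / 3 := by rwa [← dist_eq_norm]
  -- On the norming set `T` agrees with `J y`, so `T - J z` is there as small as `y - z`.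
  have hTz : ‖T - J z‖ ≤ 2 * (ε / 3) := by
    refine hG (t n) _ (Submodule.sub_mem _ hTE hJz) _ (by positivity) fun f hf => ?_
    have : (T - J z) f = f (y - z) := by
      simp [J, hTy n f hf]
    rw [this]
    calc ‖f (y - z)‖ ≤ 1 * ‖y - z‖ := f.le_of_opNorm_le (hG1 _ f hf) _
      _ ≤ ε / 3 := by linarith
  have hJyz : dist (J y) (J z) ≤ ε / 3 :=
    ((NormedSpace.inclusionInDoubleDualLi 𝕜).dist_map y z).trans_le hyz.le
  have hTz' : dist T (J z) ≤ 2 * (ε / 3) := by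
    have := dist_eq_norm T (J z)
    exact this.le.trans hTz
  calc dist (J y) T ≤ dist (J y) (J z) + dist T (J z) := dist_triangle_right _ _ _
    _ ≤ ε := by linarith

end EberleinSmulian

/-! ### Regular matrices and Cesàro means. -/

section Averaging

/-- The matrices satisfying the conditions of the Silverman–Toeplitz theorem, in the nonnegative
case. -/
structure IsAveraging (A : ℕ → ℕ → ℝ) : Prop where
  nonneg : ∀ n k, 0 ≤ A n k
  row : ∃ t : ℕ → ℝ, (∀ n, HasSum (A n) (t n)) ∧ Tendsto t atTop (𝓝 1)
  col : ∀ k, Tendsto (fun n => A n k) atTop (𝓝 0)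

/-- Testing regularity on the constant sequence `1` gives the row sums, on unit vectors the columns.
-/
theorem IsPositiveRegular.isAveraging {A : ℕ → ℕ → ℝ} (h : IsPositiveRegular A) :
    IsAveraging A where
  nonneg := h.1
  row := by
    obtain ⟨t, ht, ht1⟩ := h.2 (fun _ => 1) 1 tendsto_const_nhds
    refine ⟨fun n => (t n).re, fun n => ?_, (Complex.continuous_re.tendsto _).comp ht1⟩
    rw [hasSum_iff_tendsto_nat_of_nonneg (h.1 n)]
    simpa [Function.comp_def] using (Complex.continuous_re.tendsto _).comp (ht n)
  col := fun k => by
    obtain ⟨t, ht, ht0⟩ := h.2 (Pi.single k 1) 0 (tendsto_const_nhds.congr' <| by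
      filter_upwards [eventually_gt_atTop k] with n hn
      rw [Pi.single_eq_of_ne hn.ne'])
    have htA : ∀ n, t n = A n k := fun n => by
      refine tendsto_nhds_unique (ht n) (tendsto_const_nhds.congr' ?_)
      filter_upwards [eventually_gt_atTop k] with N hN
      simp [Pi.single_apply, hN]
    simpa [Function.comp_def, htA] using (Complex.continuous_re.tendsto _).comp ht0

/-- The matrix of Cesàro means. -/
noncomputable def cesaroMatrix (n k : ℕ) : ℝ :=
  if k ∈ Finset.range (n + 1) then 1 / ((n : ℝ) + 1) else 0

theorem isAveraging_cesaroMatrix : IsAveraging cesaroMatrix where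
  nonneg n k := by unfold cesaroMatrix; split_ifs <;> positivity
  row := by
    refine ⟨fun _ => 1, fun n => ?_, tendsto_const_nhds⟩
    have h : HasSum (cesaroMatrix n) (∑ k ∈ Finset.range (n + 1), cesaroMatrix n k) :=
      hasSum_sum_of_ne_finset_zero fun k hk => if_neg hk
    have h1 : ∑ k ∈ Finset.range (n + 1), cesaroMatrix n k = 1 := by
      refine (Finset.sum_congr rfl fun k hk => if_pos hk).trans ?_
      simp [Nat.cast_add_one_ne_zero]
    rwa [h1] at h
  col k := by
    refine tendsto_one_div_add_atTop_nhds_zero_nat.congr' ?_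
    filter_upwards [eventually_ge_atTop k] with n hn
    exact (if_pos (Finset.mem_range.2 (Nat.lt_succ_of_le hn))).symm

/-- The `A`-means of the absolute values of `s` are eventually at most `ε`. -/
def EventuallySmallMeans {𝕜 : Type*} [RCLike 𝕜] (A : ℕ → ℕ → ℝ) (s : ℕ → 𝕜) (ε : ℝ) : Prop :=
  ∀ᶠ m in atTop, ∀ F : Finset ℕ, ∑ k ∈ F, A m k * ‖s k‖ ≤ ε

theorem StronglyConverges.eventuallySmallMeans {𝕜 : Type*} [RCLike 𝕜] {A : ℕ → ℕ → ℝ}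
    {s : ℕ → 𝕜} {l : 𝕜} (hA : IsAveraging A) (h : StronglyConverges A s l) {ε : ℝ} (hε : 0 < ε) :
    EventuallySmallMeans A (fun k => s k - l) ε := by
  filter_upwards [h.2.eventually_lt_const hε] with m hm F
  exact ((h.1 m).sum_le_tsum F fun k _ => mul_nonneg (hA.nonneg m k) (norm_nonneg _)).trans hm.le

/-- Terms of size at least `ε / 2` are bounded by `C` and have density zero; the others average to
at most `ε / 2`. -/
theorem StatConverges.eventuallySmallMeans {𝕜 : Type*} [RCLike 𝕜] {s : ℕ → 𝕜} {l : 𝕜}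
    (h : StatConverges s l) {C : ℝ} (hC : ∀ k, ‖s k - l‖ ≤ C) {ε : ℝ} (hε : 0 < ε) :
    EventuallySmallMeans cesaroMatrix (fun k => s k - l) ε := by
  classical
  have h1 := (((h (ε / 2) (half_pos hε)).comp (tendsto_add_atTop_nat 1)).const_mul C)
  rw [mul_zero] at h1
  filter_upwards [h1.eventually_lt_const (half_pos hε)] with m hm F
  have hm0 : (0 : ℝ) < m + 1 := by positivity
  simp only [Function.comp_apply, Nat.cast_add, Nat.cast_one] at hm
  set P : Finset ℕ := (Finset.range (m + 1)).filter fun k => ε / 2 ≤ ‖s k - l‖ with hP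
  have hPm : C * P.card < ε / 2 * (m + 1) := by
    rw [mul_div_assoc', div_lt_iff₀ hm0] at hm
    convert hm
  have hsum : ∑ k ∈ Finset.range (m + 1), ‖s k - l‖ ≤ ε * (m + 1) := by
    calc ∑ k ∈ Finset.range (m + 1), ‖s k - l‖
        ≤ ∑ k ∈ Finset.range (m + 1), ((if ε / 2 ≤ ‖s k - l‖ then C else 0) + ε / 2) := by
          refine Finset.sum_le_sum fun k _ => ?_
          split_ifs with hk
          · linarith [hC k]
          · linarith
      _ = C * P.card + ε / 2 * (m + 1) := by
          rw [Finset.sum_add_distrib, ← Finset.sum_filter, ← hP]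
          simp only [Finset.sum_const, Finset.card_range, nsmul_eq_mul, Nat.cast_add, Nat.cast_one]
          ring
      _ ≤ ε * (m + 1) := by linarith
  calc ∑ k ∈ F, cesaroMatrix m k * ‖s k - l‖
      = ∑ k ∈ F ∩ Finset.range (m + 1), 1 / ((m : ℝ) + 1) * ‖s k - l‖ := by
        rw [← Finset.filter_mem_eq_inter, Finset.sum_filter]
        refine Finset.sum_congr rfl fun k _ => ?_
        unfold cesaroMatrix
        split_ifs <;> simp
    _ ≤ ∑ k ∈ Finset.range (m + 1), 1 / ((m : ℝ) + 1) * ‖s k - l‖ :=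
        Finset.sum_le_sum_of_subset_of_nonneg Finset.inter_subset_right
          fun k _ _ => by positivity
    _ ≤ 1 / ((m : ℝ) + 1) * (ε * (m + 1)) := by
        rw [← Finset.mul_sum]; gcongr
    _ = ε := by field_simp

end Averaging

/-! ### From `B` to all functionals, and on to cluster points. -/

section Generating

variable {𝕜 X : Type*} [RCLike 𝕜] [NormedAddCommGroup X] [NormedSpace 𝕜 X]

/-- The functionals whose `A`-means along `z` are at most `ε` from row `n` on. -/
def smallMeansSet (A : ℕ → ℕ → ℝ) (z : ℕ → X) (ε : ℝ) (n : ℕ) : Set (StrongDual 𝕜 X) :=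
  {f | ∀ m ≥ n, ∀ F : Finset ℕ, ∑ k ∈ F, A m k * ‖f (z k)‖ ≤ ε}

variable {A : ℕ → ℕ → ℝ} {z : ℕ → X} {ε : ℝ}

theorem mem_iUnion_smallMeansSet {f : StrongDual 𝕜 X} :
    f ∈ ⋃ n, smallMeansSet A z ε n ↔ EventuallySmallMeans A (fun k => f (z k)) ε := by
  rw [Set.mem_iUnion]
  exact eventually_atTop.symm

theorem monotone_smallMeansSet : Monotone (smallMeansSet (𝕜 := 𝕜) A z ε) :=
  fun _ _ h _ hf m hm => hf m (h.trans hm)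

theorem convex_smallMeansSet (hA : IsAveraging A) (n : ℕ) :
    Convex ℝ (smallMeansSet (𝕜 := 𝕜) A z ε n) := by
  intro f hf g hg a b ha hb hab m hm F
  calc ∑ k ∈ F, A m k * ‖(a • f + b • g) (z k)‖
      ≤ ∑ k ∈ F, (a * (A m k * ‖f (z k)‖) + b * (A m k * ‖g (z k)‖)) := by
        refine Finset.sum_le_sum fun k _ => ?_
        have h : ‖(a • f + b • g) (z k)‖ ≤ a * ‖f (z k)‖ + b * ‖g (z k)‖ := by
          refine (norm_add_le _ _).trans_eq ?_
          simp [norm_smul, abs_of_nonneg ha, abs_of_nonneg hb]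
        calc _ ≤ A m k * (a * ‖f (z k)‖ + b * ‖g (z k)‖) :=
              mul_le_mul_of_nonneg_left h (hA.nonneg m k)
          _ = _ := by ring
    _ = a * ∑ k ∈ F, A m k * ‖f (z k)‖ + b * ∑ k ∈ F, A m k * ‖g (z k)‖ := by
        rw [Finset.sum_add_distrib, Finset.mul_sum, Finset.mul_sum]
    _ ≤ a * ε + b * ε := by gcongr; exacts [hf m hm F, hg m hm F]
    _ = ε := by rw [← add_mul, hab, one_mul]

/-- Bounding finite sums over `F` instead of a series keeps each condition weak*-closed. -/
theorem isClosed_toWeakDual_smallMeansSet (n : ℕ) :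
    IsClosed {f : WeakDual 𝕜 X | WeakDual.toStrongDual f ∈ smallMeansSet A z ε n} := by
  have : {f : WeakDual 𝕜 X | WeakDual.toStrongDual f ∈ smallMeansSet A z ε n} =
      ⋂ m ≥ n, ⋂ F : Finset ℕ, {f : WeakDual 𝕜 X | ∑ k ∈ F, A m k * ‖f (z k)‖ ≤ ε} := by
    ext f
    simp [smallMeansSet]
  rw [this]
  refine isClosed_biInter fun m _ => isClosed_iInter fun F => isClosed_le ?_ continuous_const
  exact continuous_finsetSum _ fun k _ =>
    continuous_const.mul (WeakDual.eval_continuous (z k)).norm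

theorem weakStarClosedConvexHull_subset_smallMeansSet (hA : IsAveraging A) {n : ℕ}
    {S : Set (StrongDual 𝕜 X)} (hS : S ⊆ smallMeansSet A z ε n) :
    weakStarClosedConvexHull S ⊆ smallMeansSet A z ε n := by
  intro f hf
  have := closure_minimal (s := StrongDual.toWeakDual '' convexHull ℝ S)
    (t := {f : WeakDual 𝕜 X | WeakDual.toStrongDual f ∈ smallMeansSet A z ε n}) ?_
    (isClosed_toWeakDual_smallMeansSet n) hf
  · exact this
  · rintro _ ⟨g, hg, rfl⟩
    exact convexHull_min hS (convex_smallMeansSet hA n) hg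

theorem eventuallySmallMeans_of_mem_closure (hA : IsAveraging A) {C : ℝ} (hz : ∀ k, ‖z k‖ ≤ C)
    {f : StrongDual 𝕜 X} (hε : 0 < ε)
    (hf : f ∈ closure {g : StrongDual 𝕜 X | EventuallySmallMeans A (fun k => g (z k)) (ε / 2)}) :
    EventuallySmallMeans A (fun k => f (z k)) ε := by
  have hC : 0 ≤ C := (norm_nonneg _).trans (hz 0)
  obtain ⟨t, ht, ht1⟩ := hA.row
  -- Replacing `f` by `g` costs at most `ε / 4` per term, hence `ε / 2` in a row of mass at most
  -- `2`.
  obtain ⟨g, hg, hfg⟩ := Metric.mem_closure_iff.1 hf (ε / (4 * (C + 1))) (by positivity)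
  rw [dist_eq_norm] at hfg
  filter_upwards [hg, ht1.eventually_lt_const one_lt_two] with m hm hm2 F
  have hrow : ∑ k ∈ F, A m k ≤ 2 :=
    (sum_le_hasSum F (fun k _ => hA.nonneg m k) (ht m)).trans hm2.le
  have hdiff : ∀ k, ‖f (z k)‖ ≤ ‖g (z k)‖ + ε / 4 := fun k => by
    have h1 : ‖(f - g) (z k)‖ ≤ ε / (4 * (C + 1)) * (C + 1) :=
      (f - g).le_of_opNorm_le_of_le hfg.le ((hz k).trans (by linarith))
    have h2 : ε / (4 * (C + 1)) * (C + 1) = ε / 4 := by field_simp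
    have h3 : f (z k) = g (z k) + (f - g) (z k) := by simp
    rw [h3]
    exact (norm_add_le _ _).trans (by linarith)
  calc ∑ k ∈ F, A m k * ‖f (z k)‖
      ≤ ∑ k ∈ F, (A m k * ‖g (z k)‖ + A m k * (ε / 4)) := Finset.sum_le_sum fun k _ => by
        rw [← mul_add]; exact mul_le_mul_of_nonneg_left (hdiff k) (hA.nonneg m k)
    _ = ∑ k ∈ F, A m k * ‖g (z k)‖ + (∑ k ∈ F, A m k) * (ε / 4) := by
        rw [Finset.sum_add_distrib, Finset.sum_mul]
    _ ≤ ε / 2 + 2 * (ε / 4) := by gcongr; exact hm F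
    _ = ε := by ring

theorem IGenerates.eventuallySmallMeans {B : Set (StrongDual 𝕜 X)}
    (hB : IGenerates B (Metric.closedBall 0 1)) (hA : IsAveraging A) {C : ℝ}
    (hz : ∀ k, ‖z k‖ ≤ C)
    (h : ∀ f ∈ B, ∀ ε > 0, EventuallySmallMeans A (fun k => f (z k)) ε)
    {f : StrongDual 𝕜 X} (hf : ‖f‖ ≤ 1) (hε : 0 < ε) :
    EventuallySmallMeans A (fun k => f (z k)) ε := by
  refine eventuallySmallMeans_of_mem_closure hA hz hε ?_
  have hBC : B = ⋃ n, B ∩ smallMeansSet A z (ε / 2) n := by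
    rw [← Set.inter_iUnion, eq_comm, Set.inter_eq_left]
    exact fun g hg => mem_iUnion_smallMeansSet.2 (h g hg _ (half_pos hε))
  have hf' : f ∈ Metric.closedBall (0 : StrongDual 𝕜 X) 1 := by simpa using hf
  rw [hB.2 _ hBC] at hf'
  refine closure_mono (fun g hg => ?_) hf'
  refine mem_iUnion_smallMeansSet.1 (convexHull_min (Set.iUnion_mono fun n =>
    weakStarClosedConvexHull_subset_smallMeansSet hA Set.inter_subset_right) ?_ hg)
  exact monotone_smallMeansSet.directed_le.convex_iUnion fun n => convex_smallMeansSet hA n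

theorem EventuallySmallMeans.of_ball (h : ∀ f : StrongDual 𝕜 X, ‖f‖ ≤ 1 → ∀ ε > 0,
      EventuallySmallMeans A (fun k => f (z k)) ε) (f : StrongDual 𝕜 X) (hε : 0 < ε) :
    EventuallySmallMeans A (fun k => f (z k)) ε := by
  have hr : 0 < ‖f‖ + 1 := by positivity
  have hg : ‖((‖f‖ + 1 : ℝ) : 𝕜)⁻¹ • f‖ ≤ 1 := by
    rw [norm_smul, norm_inv, RCLike.norm_ofReal, abs_of_pos hr, inv_mul_le_iff₀ hr]
    linarith
  filter_upwards [h _ hg (ε / (‖f‖ + 1)) (by positivity)] with m hm F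
  have h1 := hm F
  simp only [smul_apply, norm_smul, norm_inv, RCLike.norm_ofReal, abs_of_pos hr] at h1
  rw [le_div_iff₀ hr, Finset.sum_mul] at h1
  refine (Finset.sum_congr rfl fun k _ => ?_).trans_le h1
  field_simp

theorem isWeakClusterPt_of_eventuallySmallMeans (hA : IsAveraging A) {x : ℕ → X} {y : X}
    (h : ∀ (f : StrongDual 𝕜 X), ∀ ε > 0, EventuallySmallMeans A (fun k => f (x k - y)) ε) :
    IsWeakClusterPt 𝕜 x y := by
  intro S ε hε N
  by_contra! hcon
  -- With this `c` the means of all `f ∈ S` add up to at most `ε / 4`. Head and tail then have mass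
  -- at most `1 / 4` each, against a row mass above `3 / 4`.
  let c : ℝ := ε / (4 * (S.card + 1))
  have hc : 0 < c := by positivity
  have hev : ∀ᶠ m in atTop, ∀ f ∈ S, ∀ F : Finset ℕ, ∑ k ∈ F, A m k * ‖f (x k - y)‖ ≤ c :=
    (eventually_all_finset S).2 fun f _ => h f c hc
  have hhead : Tendsto (fun m => ∑ k ∈ Finset.range N, A m k) atTop (𝓝 0) := by
    simpa using tendsto_finsetSum (Finset.range N) fun k _ => hA.col k
  obtain ⟨t, ht, ht1⟩ := hA.row
  obtain ⟨m, hm, hm0, hm1⟩ := (hev.and ((hhead.eventually_lt_const (u := 1 / 4) (by norm_num)).and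
    (ht1.eventually_const_lt (u := 3 / 4) (by norm_num)))).exists
  obtain ⟨F, hF⟩ := ((ht m).eventually_const_lt hm1).exists
  have htail : ε * ∑ k ∈ F \ Finset.range N, A m k ≤ ε / 4 := by
    calc ε * ∑ k ∈ F \ Finset.range N, A m k
        = ∑ k ∈ F \ Finset.range N, A m k * ε := by rw [Finset.mul_sum]; simp only [mul_comm]
      _ ≤ ∑ k ∈ F \ Finset.range N, ∑ f ∈ S, A m k * ‖f (x k - y)‖ := by
          refine Finset.sum_le_sum fun k hk => ?_
          obtain ⟨f, hf, hfk⟩ := hcon k (by simpa using (Finset.mem_sdiff.1 hk).2)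
          rw [← map_sub] at hfk
          exact (mul_le_mul_of_nonneg_left hfk (hA.nonneg m k)).trans
            (Finset.single_le_sum (f := fun f : StrongDual 𝕜 X => A m k * ‖f (x k - y)‖)
              (fun f _ => mul_nonneg (hA.nonneg m k) (norm_nonneg _)) hf)
      _ = ∑ f ∈ S, ∑ k ∈ F \ Finset.range N, A m k * ‖f (x k - y)‖ := Finset.sum_comm
      _ ≤ ∑ f ∈ S, c := Finset.sum_le_sum fun f hf => hm f hf _
      _ = S.card * c := by simp
      _ ≤ (S.card + 1) * c := by gcongr; linarith
      _ = ε / 4 := by simp only [c]; field_simp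
  have htail' : ∑ k ∈ F \ Finset.range N, A m k ≤ 1 / 4 :=
    le_of_mul_le_mul_left (htail.trans_eq (by ring)) hε
  have hsplit : ∑ k ∈ F, A m k ≤ ∑ k ∈ Finset.range N, A m k + ∑ k ∈ F \ Finset.range N, A m k := by
    rw [← Finset.sum_union Finset.disjoint_sdiff]
    exact Finset.sum_le_sum_of_subset_of_nonneg (by simp) fun k _ _ => hA.nonneg m k
  linarith

theorem IGenerates.isWeakClusterPt {B : Set (StrongDual 𝕜 X)}
    (hB : IGenerates B (Metric.closedBall 0 1)) (hA : IsAveraging A) {x : ℕ → X} {y : X} {C : ℝ}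
    (hx : ∀ k, ‖x k‖ ≤ C)
    (h : ∀ f ∈ B, ∀ ε > 0, EventuallySmallMeans A (fun k => f (x k) - f y) ε) :
    IsWeakClusterPt 𝕜 x y := by
  refine isWeakClusterPt_of_eventuallySmallMeans hA fun f ε hε => ?_
  refine EventuallySmallMeans.of_ball (z := fun k => x k - y) (fun f hf ε hε => ?_) f hε
  refine hB.eventuallySmallMeans hA (C := C + ‖y‖)
    (fun k => (norm_sub_le _ _).trans (by linarith [hx k])) (fun f hf ε hε => ?_) hf hε
  simpa only [map_sub] using h f hf ε hε

theorem IsWeakClusterPt.of_comp {x : ℕ → X} {y : X} {φ : ℕ → ℕ} (hφ : StrictMono φ)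
    (h : IsWeakClusterPt 𝕜 (fun k => x (φ k)) y) : IsWeakClusterPt 𝕜 x y := fun S ε hε N =>
  let ⟨k, hk, hkS⟩ := h S ε hε N
  ⟨φ k, hk.trans hφ.le_apply, hkS⟩

end Generating
end WeakCom

theorem corollary3p7 {𝕜 X : Type*} [RCLike 𝕜] [NormedAddCommGroup X] [NormedSpace 𝕜 X]
    [CompleteSpace X] (B : Set (StrongDual 𝕜 X))
    (hB : WeakCom.IGenerates B (Metric.closedBall (0 : StrongDual 𝕜 X) 1))
    (M : Set X) (hM : Bornology.IsBounded M) :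
    ((∀ x : ℕ → X, (∀ n, x n ∈ M) →
        ∃ A : ℕ → ℕ → ℝ, WeakCom.IsPositiveRegular A ∧
          ∃ y : X, ∀ f ∈ B, WeakCom.StronglyConverges A (fun n => f (x n)) (f y)) →
      WeakCom.IsRelativelyWeaklyCompact 𝕜 M) ∧
    ((∀ x : ℕ → X, (∀ n, x n ∈ M) →
        ∃ φ : ℕ → ℕ, StrictMono φ ∧
          ∃ y : X, ∀ f ∈ B, WeakCom.StatConverges (fun n => f (x (φ n))) (f y)) →
      WeakCom.IsRelativelyWeaklyCompact 𝕜 M) := by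
  obtain ⟨C, hC⟩ := hM.exists_norm_le
  constructor
  · intro h
    refine WeakCom.isRelativelyWeaklyCompact_of_forall_exists_isWeakClusterPt hM fun x hx => ?_
    obtain ⟨A, hA, y, hy⟩ := h x hx
    exact ⟨y, hB.isWeakClusterPt hA.isAveraging (fun k => hC _ (hx k)) fun f hf ε hε =>
      (hy f hf).eventuallySmallMeans hA.isAveraging hε⟩
  · intro h
    refine WeakCom.isRelativelyWeaklyCompact_of_forall_exists_isWeakClusterPt hM fun x hx => ?_
    obtain ⟨φ, hφ, y, hy⟩ := h x hx
    refine ⟨y, .of_comp hφ (hB.isWeakClusterPt WeakCom.isAveraging_cesaroMatrix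
      (fun k => hC _ (hx (φ k))) fun f hf ε hε => ?_)⟩
    -- Boundedness of `M` supplies the bound needed to pass from density to means.
    refine (hy f hf).eventuallySmallMeans (C := ‖f‖ * (C + ‖y‖)) (fun k => ?_) hε
    rw [← map_sub]
    exact f.le_opNorm_of_le ((norm_sub_le _ _).trans (by linarith [hC _ (hx (φ k))]))
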